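/- Let $H$ be a hypergroup, i.e. a non-empty locally compact Hausdorff space with a convolution $\ast$ of bounded Radon measures that makes them an algebra and is determined by its values on point masses, $\int g\,d(\mu\ast\nu)=\int\!\int\!\left(\int g\,d(\delta_x\ast\delta_y)\right)d\mu(x)\,d\nu(y)$, such that: each $\delta_x\ast\delta_y$ is a probability measure with compact support; $(x,y)\mapsto\delta_x\ast\delta_y$ is continuous for the weak topology on probability measures and $(x,y)\mapsto\operatorname{supp}(\delta_x\ast\delta_y)$ is continuous for the Michael (Vietoris) topology on compact sets; there is an element $e$ with $\delta_x\ast\delta_e=\delta_e\ast\delta_x=\delta_x$ for all $x$; and there is a homeomorphism $x\mapsto\check x$ of $H$ with $\check{\check x}=x$, $(\mu\ast\nu)\check{}=\check\nu\ast\check\mu$, and $e\in\operatorname{supp}(\delta_x\ast\delta_y)$ if and only if $y=\check x$. For a measure $\mu$ and a function $f$ put $(\mu\ast f)(x)=\int\!\int f\,d(\delta_{\check y}\ast\delta_x)\,d\mu(y)$. Let $C(H)$ be the Banach space of bounded continuous complex functions on $H$, and let $WUCB_r(H)$ be the space of all $f\in C(H)$ for which $x\mapsto\delta_x\ast f$ is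 continuous from $H$ to $C(H)$ with its weak topology. A left invariant mean on $WUCB_r(H)$ is a bounded linear functional $m$ with $\|m\|=m(1)=1$ and $m(\delta_x\ast f)=m(f)$ for all $x\in H$ and $f\in WUCB_r(H)$. Suppose that for some non-zero, non-negative, continuous, compactly supported function $f$ on $H$, $H$ has the positivity property of translations of $f$: for all positive bounded regular Borel measures $\mu,\nu$ on $H$, if $\mu\ast f\le\nu\ast f$ pointwise, then $\|\mu\|\le\|\nu\|$. Suppose also that $WUCB_r(H)$ has a left invariant mean. Then $H$ has a left Haar measure, i.e. a non-zero regular Borel measure $\lambda$ with values in $[0,\infty]$ such that $\int \delta_x\ast g\,d\lambda=\int g\,d\lambda$ for all $x\in H$ and all continuous compactly supported $g:H\to\mathbb{C}$. -/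

import Mathlib

open MeasureTheory TopologicalSpace Filter Topology
open scoped BoundedContinuousFunction

/-- A (locally compact) hypergroup structure on a topological space `H`, which is meant to be
locally compact and Hausdorff and to carry its Borel σ-algebra.

The convolution of bounded Radon measures is given by its values `conv x y = δ_x ∗ δ_y` on point
masses, through `∫ g d(μ ∗ ν) = ∫ ∫ (∫ g d(δ_x ∗ δ_y)) dμ(x) dν(y)`; it is bilinear by this
formula, and it is associative exactly if it is so on point masses. -/
structure Hypergroup (H : Type*) [TopologicalSpace H] [MeasurableSpace H] [BorelSpace H] where
  /-- The probability measure `δ_x ∗ δ_y`. -/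
  conv : H → H → ProbabilityMeasure H
  /-- `δ_x ∗ δ_y` is a Radon measure. -/
  regular_conv : ∀ x y, (conv x y : Measure H).Regular
  /-- `(δ_x ∗ δ_y) ∗ δ_z = δ_x ∗ (δ_y ∗ δ_z)`, tested on bounded continuous functions. -/
  conv_assoc : ∀ (x y z : H) (g : H →ᵇ ℂ),
    ∫ t, (∫ s, g s ∂(conv t z : Measure H)) ∂(conv x y : Measure H) =
      ∫ t, (∫ s, g s ∂(conv x t : Measure H)) ∂(conv y z : Measure H)
  /-- `(x, y) ↦ δ_x ∗ δ_y` is continuous for the weak topology on probability measures. -/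
  continuous_conv : Continuous fun p : H × H => conv p.1 p.2
  /-- `δ_x ∗ δ_y` has compact support. -/
  isCompact_support : ∀ x y, IsCompact (conv x y : Measure H).support
  /-- `(x, y) ↦ supp (δ_x ∗ δ_y)` is continuous for the Michael (Vietoris) topology, which is
  the topology of `Compacts H`. -/
  continuous_support :
    Continuous fun p : H × H => (⟨_, isCompact_support p.1 p.2⟩ : Compacts H)
  /-- The identity element (the next two fields determine it). -/
  e : H
  e_conv : ∀ x, (conv e x : Measure H) = Measure.dirac x
  conv_e : ∀ x, (conv x e : Measure H) = Measure.dirac x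
  /-- The involution `x ↦ x̌`. -/
  inv : H ≃ₜ H
  inv_inv : ∀ x, inv (inv x) = x
  /-- `(δ_x ∗ δ_y)ˇ = δ_y̌ ∗ δ_x̌`. -/
  map_inv_conv : ∀ x y,
    (conv x y : Measure H).map inv = (conv (inv y) (inv x) : Measure H)
  e_mem_support_iff : ∀ x y, e ∈ (conv x y : Measure H).support ↔ y = inv x

namespace Hypergroup

variable {H : Type*} [TopologicalSpace H] [MeasurableSpace H] [BorelSpace H]

/-- The convolution `μ ∗ f` of a positive measure and a function,
`(μ ∗ f)(x) = ∫ f(y̌ ∗ x) dμ(y)`, where `f(a ∗ b)` stands for `∫ f d(δ_a ∗ δ_b)`. -/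
noncomputable def convFun (K : Hypergroup H) {E : Type*} [NormedAddCommGroup E] [NormedSpace ℝ E]
    (μ : Measure H) (f : H → E) (x : H) : E :=
  ∫ y, (∫ t, f t ∂(K.conv (K.inv y) x : Measure H)) ∂μ

theorem convFun_dirac [T2Space H] (K : Hypergroup H) {E : Type*} [NormedAddCommGroup E]
    [NormedSpace ℝ E] [CompleteSpace E] (x : H) (f : H → E) (y : H) :
    K.convFun (Measure.dirac x) f y = ∫ t, f t ∂(K.conv (K.inv x) y : Measure H) := by
  simp only [convFun, integral_dirac]

/-- The left translate `δ_x ∗ f` of a bounded continuous function, as a bounded continuous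
function. -/
noncomputable def leftTranslate [T2Space H] (K : Hypergroup H) (x : H) (f : H →ᵇ ℂ) : H →ᵇ ℂ :=
  BoundedContinuousFunction.ofNormedAddCommGroup (K.convFun (Measure.dirac x) f)
    (by
      have h : Continuous fun y : H => K.conv (K.inv x) y :=
        K.continuous_conv.comp (Continuous.prodMk_right (K.inv x))
      have h2 : (K.convFun (Measure.dirac x) f) =
          fun y => ∫ t, f t ∂(K.conv (K.inv x) y : Measure H) :=
        funext fun y => K.convFun_dirac x f y
      rw [h2, continuous_iff_continuousAt]
      intro y
      exact (ProbabilityMeasure.tendsto_iff_forall_integral_rclike_tendsto ℂ).1 (h.tendsto y) f)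
    ‖f‖
    (by
      intro y
      rw [convFun_dirac]
      refine (norm_integral_le_of_norm_le_const (C := ‖f‖)
        (Eventually.of_forall fun t => f.norm_coe_le_norm t)).trans ?_
      simp)

theorem leftTranslate_apply [T2Space H] (K : Hypergroup H) (x : H) (f : H →ᵇ ℂ) (y : H) :
    K.leftTranslate x f y = ∫ t, f t ∂(K.conv (K.inv x) y : Measure H) :=
  K.convFun_dirac x f y

theorem leftTranslate_add [T2Space H] (K : Hypergroup H) (x : H) (f g : H →ᵇ ℂ) :
    K.leftTranslate x (f + g) = K.leftTranslate x f + K.leftTranslate x g := by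
  ext y
  simp only [leftTranslate_apply, BoundedContinuousFunction.add_apply]
  exact integral_add (f.integrable _) (g.integrable _)

theorem leftTranslate_smul [T2Space H] (K : Hypergroup H) (x : H) (c : ℂ) (f : H →ᵇ ℂ) :
    K.leftTranslate x (c • f) = c • K.leftTranslate x f := by
  ext y
  simp only [leftTranslate_apply, BoundedContinuousFunction.smul_apply]
  exact integral_smul c f

theorem leftTranslate_one [T2Space H] (K : Hypergroup H) (x : H) :
    K.leftTranslate x (1 : H →ᵇ ℂ) = 1 := by
  ext y
  simp [leftTranslate_apply]

/-- The space of weakly right uniformly continuous functions: those bounded continuous `f` for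
which `x ↦ δ_x ∗ f` is continuous into the space of bounded continuous functions with its weak
topology. -/
noncomputable def WUCB [T2Space H] (K : Hypergroup H) : Submodule ℂ (H →ᵇ ℂ) where
  carrier := {f | ∀ F : (H →ᵇ ℂ) →L[ℂ] ℂ, Continuous fun x => F (K.leftTranslate x f)}
  zero_mem' := by
    intro F
    have h : ∀ x, K.leftTranslate x 0 = 0 := fun x => by
      simpa using K.leftTranslate_smul x 0 0
    simp only [h]
    exact continuous_const
  add_mem' := by
    intro f g hf hg F
    simp only [leftTranslate_add, map_add]
    exact (hf F).add (hg F)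
  smul_mem' := by
    intro c f hf F
    simp only [leftTranslate_smul, map_smul]
    exact (hf F).const_smul c

theorem one_mem_WUCB [T2Space H] (K : Hypergroup H) : (1 : H →ᵇ ℂ) ∈ K.WUCB := by
  intro F
  simp only [leftTranslate_one]
  exact continuous_const

/-- `m` is a left invariant mean on the weakly right uniformly continuous functions: a functional
with `‖m‖ = 1 = m(1)` and `m(δ_x ∗ f) = m(f)`. (That `δ_x ∗ f` lies in the space again is a
theorem; it is only carried along here to form `m(δ_x ∗ f)`.) -/
def IsLeftInvariantMean [T2Space H] (K : Hypergroup H) (m : K.WUCB →L[ℂ] ℂ) : Prop :=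
  ‖m‖ = 1 ∧ m ⟨1, K.one_mem_WUCB⟩ = 1 ∧
    ∀ (x : H) (f : H →ᵇ ℂ) (hf : f ∈ K.WUCB) (hxf : K.leftTranslate x f ∈ K.WUCB),
      m ⟨K.leftTranslate x f, hxf⟩ = m ⟨f, hf⟩

/-- The positivity property of translations of `f`: for all positive bounded regular Borel
measures, `μ ∗ f ≤ ν ∗ f` implies `‖μ‖ ≤ ‖ν‖`. The norm of a positive measure is its total mass. -/
def PositivityOfTranslations (K : Hypergroup H) (f : H → ℝ) : Prop :=
  ∀ (μ ν : Measure H) [IsFiniteMeasure μ] [IsFiniteMeasure ν] [μ.Regular] [ν.Regular],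
    (∀ x, K.convFun μ f x ≤ K.convFun ν f x) → μ Set.univ ≤ ν Set.univ

/-- `ℓ` is a left Haar measure: a non-zero regular Borel measure with
`ℓ(δ_x ∗ g) = ℓ(g)` for all `x` and all continuous compactly supported `g`
(including that `δ_x ∗ g` is integrable). -/
structure IsLeftHaar (K : Hypergroup H) (ℓ : Measure H) : Prop where
  regular : ℓ.Regular
  ne_zero : ℓ ≠ 0
  integrable : ∀ (x : H) (g : H → ℂ), Continuous g → HasCompactSupport g →
    Integrable (K.convFun (Measure.dirac x) g) ℓ
  invariant : ∀ (x : H) (g : H → ℂ), Continuous g → HasCompactSupport g →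
    ∫ y, K.convFun (Measure.dirac x) g y ∂ℓ = ∫ y, g y ∂ℓ

end Hypergroup

/-!
The functional `μ ∗ f ↦ ‖μ‖` is, by the positivity property, monotone on the differences
`μ ∗ f - ν ∗ f`. Hence `g ↦ inf {‖μ‖ - ‖ν‖ : g ≤ μ ∗ f - ν ∗ f}` is a sublinear functional on the
real compactly supported continuous functions, and by Hahn–Banach a linear functional `Λ` lies
below it (`exists_linear_le_massGaps`). Such a `Λ` is positive, has the value `1` on every translate
of `f`, and is bounded along the translates of every `g` (`exists_normalized_functional`), because
finitely many translates of `f` dominate `g` (`exists_dominating`).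

`Λ` need not be invariant, so it is averaged: `φ_g(x) = Λ(δ_x̌ ∗ g)` is a bounded continuous function
(`orbitFun`), and `δ_y ∗ φ_g = φ_{δ_y ∗ g}` (`leftTranslate_orbitFun`). As `y ↦ δ_y ∗ g` is continuous
for the uniform norm, with locally common compact support (`exists_trans_near`), `φ_g` is translated
norm continuously and is thus in the domain of the invariant mean `m` (`orbitFun_mem_WUCB`). So
`g ↦ Re m(φ_g)` is a positive left invariant functional. It is not zero, since `φ_f = 1`, and the
measure that represents it is a left Haar measure.

That translates of compactly supported functions are compactly supported, and that translates of `f`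
can be made positive at any given point, rests on the equivalence of `z ∈ supp(δ_x ∗ δ_y)` and
`y ∈ supp(δ_x̌ ∗ δ_z)` (`mem_support_inv_conv`).
-/

open scoped CompactlySupported

namespace Hypergroup

variable {H : Type*} [TopologicalSpace H] [MeasurableSpace H] [BorelSpace H]

/-! ### Supports of convolutions -/

theorem continuous_integral_conv (K : Hypergroup H) (g : H →ᵇ ℝ) :
    Continuous fun p : H × H => ∫ t, g t ∂(K.conv p.1 p.2 : Measure H) :=
  continuous_iff_continuousAt.2 fun p =>
    (ProbabilityMeasure.tendsto_iff_forall_integral_tendsto).1 (K.continuous_conv.tendsto p) g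

theorem conv_assoc_real (K : Hypergroup H) (x y z : H) (g : H →ᵇ ℝ) :
    ∫ t, (∫ s, g s ∂(K.conv t z : Measure H)) ∂(K.conv x y : Measure H) =
      ∫ t, (∫ s, g s ∂(K.conv x t : Measure H)) ∂(K.conv y z : Measure H) := by
  have h := K.conv_assoc x y z (BoundedContinuousFunction.ofNormedAddCommGroup
    (fun x => (g x : ℂ)) (by fun_prop) ‖g‖ fun x => by simpa using g.norm_coe_le_norm x)
  simp only [BoundedContinuousFunction.coe_ofNormedAddCommGroup, integral_complex_ofReal] at h
  exact_mod_cast h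

instance instRegularConv (K : Hypergroup H) (x y : H) : (K.conv x y : Measure H).Regular :=
  K.regular_conv x y

theorem ae_mem_support_conv [T2Space H] (K : Hypergroup H) (x y : H) :
    ∀ᵐ t ∂(K.conv x y : Measure H), t ∈ (K.conv x y : Measure H).support :=
  Measure.support_mem_ae_of_regular

/-- The product `A ∗ B` of two sets, the union of the supports of the measures `δ_a ∗ δ_b`. -/
def setConv (K : Hypergroup H) (A B : Set H) : Set H :=
  ⋃ p ∈ A ×ˢ B, (K.conv p.1 p.2 : Measure H).support

theorem isCompact_setConv (K : Hypergroup H) {A B : Set H} (hA : IsCompact A) (hB : IsCompact B) :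
    IsCompact (K.setConv A B) := by
  have h := Compacts.isCompact_biUnion_coe_of_isCompact
    ((hA.prod hB).image K.continuous_support)
  rwa [Set.biUnion_image] at h

theorem mem_setConv (K : Hypergroup H) {A B : Set H} {x : H} :
    x ∈ K.setConv A B ↔ ∃ a ∈ A, ∃ b ∈ B, x ∈ (K.conv a b : Measure H).support := by
  simp only [setConv, Set.mem_iUnion, Set.mem_prod, Prod.exists, exists_prop]
  tauto

theorem integral_pos_of_mem_support {X : Type*} [TopologicalSpace X] [MeasurableSpace X]
    {μ : Measure X} {g : X → ℝ} (hg : Continuous g) (hi : Integrable g μ) (h0 : ∀ x, 0 ≤ g x)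
    {x : X} (hx : x ∈ μ.support) (hgx : 0 < g x) : 0 < ∫ t, g t ∂μ := by
  rw [integral_pos_iff_support_of_nonneg h0 hi]
  refine (Measure.mem_support_iff_forall x).1 hx _ ((hg.isOpen_support).mem_nhds ?_)
  exact hgx.ne'

theorem exists_mem_support_of_integral_ne_zero {X : Type*} [TopologicalSpace X] [T2Space X]
    [MeasurableSpace X] [OpensMeasurableSpace X] {μ : Measure X} [μ.Regular] {g : X → ℝ}
    (h : ∫ t, g t ∂μ ≠ 0) : ∃ x ∈ μ.support, g x ≠ 0 := by
  by_contra! hc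
  refine h (integral_eq_zero_of_ae ?_)
  filter_upwards [Measure.support_mem_ae_of_regular (μ := μ)] with x hx using hc x hx

/-- Urysohn's lemma for a point outside a compact set. -/
theorem exists_bump {X : Type*} [TopologicalSpace X] [T2Space X] [LocallyCompactSpace X]
    {S : Set X} (hS : IsCompact S) {x : X} (hx : x ∉ S) :
    ∃ g : X →ᵇ ℝ, (∀ y, 0 ≤ g y) ∧ 0 < g x ∧ ∀ y ∈ S, g y = 0 := by
  obtain ⟨g, h1, h0, -, hI⟩ := exists_continuous_one_zero_of_isCompact
    (isCompact_singleton (x := x)) hS.isClosed (by simpa using hx)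
  refine ⟨BoundedContinuousFunction.ofNormedAddCommGroup g g.continuous 1 fun y => ?_,
    fun y => (hI y).1, ?_, fun y hy => h0 hy⟩
  · rw [Real.norm_of_nonneg (hI y).1]; exact (hI y).2
  · have := h1 rfl
    simp only [BoundedContinuousFunction.coe_ofNormedAddCommGroup]
    rw [this]; exact one_pos

/-- The set-theoretic associativity of convolution: the supports of `(δ_x ∗ δ_y) ∗ δ_z` and of
`δ_x ∗ (δ_y ∗ δ_z)` agree. -/
theorem setConv_support_assoc [T2Space H] [LocallyCompactSpace H] (K : Hypergroup H) (x y z : H) :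
    K.setConv (K.conv x y : Measure H).support {z} =
      K.setConv {x} (K.conv y z : Measure H).support := by
  have hc1 : ∀ g : H →ᵇ ℝ, Continuous fun t => ∫ s, g s ∂(K.conv t z : Measure H) := fun g =>
    (K.continuous_integral_conv g).comp (Continuous.prodMk_left z)
  have hc2 : ∀ g : H →ᵇ ℝ, Continuous fun t => ∫ s, g s ∂(K.conv x t : Measure H) := fun g =>
    (K.continuous_integral_conv g).comp (Continuous.prodMk_right x)
  have hb : ∀ (g : H →ᵇ ℝ) (μ : H → ProbabilityMeasure H) (κ : ProbabilityMeasure H),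
      (Continuous fun t => ∫ s, g s ∂(μ t : Measure H)) →
      Integrable (fun t => ∫ s, g s ∂(μ t : Measure H)) (κ : Measure H) := by
    intro g μ κ h
    refine Integrable.of_bound h.aestronglyMeasurable ‖g‖ (Eventually.of_forall fun t => ?_)
    refine (norm_integral_le_of_norm_le_const (C := ‖g‖)
        (Eventually.of_forall fun t => g.norm_coe_le_norm t)).trans ?_
    simp
  ext w
  -- A bump function at `w` that vanishes on one of the two compact sets has integral zero in one
  -- order of convolution, and a positive integral in the other if `w` lies in the other set.
  constructor
  · intro hw
    by_contra hn
    obtain ⟨g, h0, hgw, hg⟩ := exists_bump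
      (K.isCompact_setConv isCompact_singleton (K.isCompact_support y z)) hn
    obtain ⟨t, ht, b, hb', hwt⟩ := K.mem_setConv.1 hw
    obtain rfl : b = z := hb'
    have hpos := integral_pos_of_mem_support (hc1 g) (hb g (fun t => K.conv t b) _ (hc1 g))
      (fun t => integral_nonneg h0) ht
      (integral_pos_of_mem_support g.continuous (g.integrable _) h0 hwt hgw)
    rw [K.conv_assoc_real] at hpos
    obtain ⟨t, ht, hne⟩ := exists_mem_support_of_integral_ne_zero hpos.ne'
    obtain ⟨s, hs, hne⟩ := exists_mem_support_of_integral_ne_zero hne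
    exact hne (hg s (K.mem_setConv.2 ⟨x, rfl, t, ht, hs⟩))
  · intro hw
    by_contra hn
    obtain ⟨g, h0, hgw, hg⟩ := exists_bump
      (K.isCompact_setConv (K.isCompact_support x y) isCompact_singleton) hn
    obtain ⟨b, hb', t, ht, hwt⟩ := K.mem_setConv.1 hw
    obtain rfl : b = x := hb'
    have hpos := integral_pos_of_mem_support (hc2 g) (hb g (fun t => K.conv b t) _ (hc2 g))
      (fun t => integral_nonneg h0) ht
      (integral_pos_of_mem_support g.continuous (g.integrable _) h0 hwt hgw)
    rw [← K.conv_assoc_real] at hpos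
    obtain ⟨t, ht, hne⟩ := exists_mem_support_of_integral_ne_zero hpos.ne'
    obtain ⟨s, hs, hne⟩ := exists_mem_support_of_integral_ne_zero hne
    exact hne (hg s (K.mem_setConv.2 ⟨t, ht, z, rfl, hs⟩))

theorem inv_mem_support_of_mem (K : Hypergroup H) {x y z : H}
    (h : z ∈ (K.conv x y : Measure H).support) :
    K.inv z ∈ (K.conv (K.inv y) (K.inv x) : Measure H).support := by
  rw [Measure.mem_support_iff_forall] at h ⊢
  intro U hU
  rw [← K.map_inv_conv]
  refine lt_of_lt_of_le (h (K.inv ⁻¹' U) (K.inv.continuous.continuousAt.preimage_mem_nhds hU)) ?_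
  exact Measure.le_map_apply K.inv.continuous.measurable.aemeasurable U

/-- `z ∈ x ∗ y` implies `y ∈ x̌ ∗ z`: both say that `e` lies in the product of `ž`, `x`, `y`. -/
theorem mem_support_inv_conv [T2Space H] [LocallyCompactSpace H] (K : Hypergroup H) {x y z : H}
    (h : z ∈ (K.conv x y : Measure H).support) :
    y ∈ (K.conv (K.inv x) z : Measure H).support := by
  have h1 : K.e ∈ K.setConv {K.inv z} (K.conv x y : Measure H).support :=
    K.mem_setConv.2 ⟨_, rfl, z, h, (K.e_mem_support_iff _ _).2 (K.inv_inv z).symm⟩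
  rw [← setConv_support_assoc] at h1
  obtain ⟨s, hs, b, rfl, he⟩ := K.mem_setConv.1 h1
  have h2 := K.inv_mem_support_of_mem hs
  rwa [K.inv_inv, ← (K.e_mem_support_iff _ _).1 he] at h2

theorem support_conv_nonempty [T2Space H] (K : Hypergroup H) (x y : H) :
    (K.conv x y : Measure H).support.Nonempty :=
  (K.ae_mem_support_conv x y).exists

/-! ### Translates and convolutions of compactly supported functions -/

/-- A compactly supported continuous function, as a bounded continuous function. -/
noncomputable def ofCc {X : Type*} [TopologicalSpace X] (g : C_c(X, ℝ)) : X →ᵇ ℝ :=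
  BoundedContinuousFunction.ofNormedAddCommGroup g g.continuous
    (g.hasCompactSupport.exists_bound_of_continuous g.continuous).choose
    (g.hasCompactSupport.exists_bound_of_continuous g.continuous).choose_spec

@[simp]
theorem ofCc_apply {X : Type*} [TopologicalSpace X] (g : C_c(X, ℝ)) (x : X) : ofCc g x = g x := rfl

theorem continuous_integral_inv_conv (K : Hypergroup H) (g : C_c(H, ℝ)) :
    Continuous fun p : H × H => ∫ t, g t ∂(K.conv (K.inv p.1) p.2 : Measure H) :=
  (K.continuous_integral_conv (ofCc g)).comp
    ((K.inv.continuous.comp continuous_fst).prodMk continuous_snd)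

theorem integrable_conv (K : Hypergroup H) (g : C_c(H, ℝ)) (x y : H) :
    Integrable g (K.conv x y : Measure H) := (ofCc g).integrable _

theorem inv_e (K : Hypergroup H) : K.inv K.e = K.e := by
  have h : K.e ∈ (K.conv K.e K.e : Measure H).support := by
    rw [K.e_conv, Measure.mem_support_iff_forall]
    intro U hU
    rw [Measure.dirac_apply_of_mem (mem_of_mem_nhds hU)]
    exact one_pos
  exact ((K.e_mem_support_iff _ _).1 h).symm

theorem integral_conv_eq_inv (K : Hypergroup H) (x y : H) {F : H → ℝ} (hF : Continuous F) :
    ∫ t, F t ∂(K.conv (K.inv y) (K.inv x) : Measure H) =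
      ∫ t, F (K.inv t) ∂(K.conv x y : Measure H) := by
  rw [← K.map_inv_conv, integral_map K.inv.continuous.measurable.aemeasurable
    hF.aestronglyMeasurable]

theorem convFun_integrable (K : Hypergroup H) (f : C_c(H, ℝ)) (μ : Measure H) [IsFiniteMeasure μ]
    (x : H) : Integrable (fun y => ∫ t, f t ∂(K.conv (K.inv y) x : Measure H)) μ := by
  refine Integrable.of_bound ((K.continuous_integral_inv_conv f).comp
    (Continuous.prodMk_left x)).aestronglyMeasurable ‖ofCc f‖ (Eventually.of_forall fun y => ?_)
  refine (norm_integral_le_of_norm_le_const (C := ‖ofCc f‖)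
        (Eventually.of_forall fun t => (ofCc f).norm_coe_le_norm t)).trans ?_
  simp

theorem convFun_add (K : Hypergroup H) (f : C_c(H, ℝ)) (μ ν : Measure H) [IsFiniteMeasure μ]
    [IsFiniteMeasure ν] (x : H) :
    K.convFun (μ + ν) f x = K.convFun μ f x + K.convFun ν f x :=
  integral_add_measure (K.convFun_integrable f μ x) (K.convFun_integrable f ν x)

theorem convFun_smul (K : Hypergroup H) (f : C_c(H, ℝ)) (c : NNReal) (μ : Measure H) (x : H) :
    K.convFun (c • μ) f x = c * K.convFun μ f x :=
  integral_smul_nnreal_measure _ c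

/-! ### Positivity of means -/

/-- A functional with `‖m‖ = 1 = m(1)` is positive. -/
theorem IsLeftInvariantMean.re_nonneg [T2Space H] {K : Hypergroup H} {m : K.WUCB →L[ℂ] ℂ}
    (hm : K.IsLeftInvariantMean m) {φ : H →ᵇ ℂ} (hφ : φ ∈ K.WUCB) {r : H → ℝ}
    (hr : ∀ x, 0 ≤ r x) (h : ∀ x, φ x = r x) : 0 ≤ (m ⟨φ, hφ⟩).re := by
  have hrle : ∀ x, r x ≤ ‖φ‖ := fun x => by
    have := φ.norm_coe_le_norm x
    rwa [h, Complex.norm_real, Real.norm_of_nonneg (hr x)] at this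
  let one : K.WUCB := ⟨1, K.one_mem_WUCB⟩
  have hnorm : ‖(‖φ‖ : ℂ) • one - ⟨φ, hφ⟩‖ ≤ ‖φ‖ := by
    change ‖(‖φ‖ : ℂ) • (1 : H →ᵇ ℂ) - φ‖ ≤ ‖φ‖
    refine (BoundedContinuousFunction.norm_le (norm_nonneg _)).2 fun x => ?_
    have : ((‖φ‖ : ℂ) • (1 : H →ᵇ ℂ) - φ) x = ((‖φ‖ - r x : ℝ) : ℂ) := by simp [h]
    rw [this, Complex.norm_real, Real.norm_of_nonneg (sub_nonneg.2 (hrle x))]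
    linarith [hr x]
  have hle := m.le_of_opNorm_le hm.1.le ((‖φ‖ : ℂ) • one - ⟨φ, hφ⟩)
  rw [map_sub, map_smul, hm.2.1, one_mul, smul_eq_mul, mul_one] at hle
  have := (Complex.re_le_norm _).trans (hle.trans hnorm)
  rw [Complex.sub_re, Complex.ofReal_re] at this
  linarith

/-! ### The sublinear functional defined by the masses -/

/-- The values `‖μ‖ - ‖ν‖`, for finite regular measures with `g ≤ μ ∗ f - ν ∗ f`. The infimum of
this set is a sublinear function of `g`. -/
def massGaps (K : Hypergroup H) (f g : C_c(H, ℝ)) : Set ℝ :=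
  {r | ∃ μ ν : Measure H, IsFiniteMeasure μ ∧ IsFiniteMeasure ν ∧ μ.Regular ∧ ν.Regular ∧
    (∀ x, g x + K.convFun ν f x ≤ K.convFun μ f x) ∧ r = μ.real Set.univ - ν.real Set.univ}

/-- The positivity property of translations, in terms of `massGaps`: it keeps the infimum finite, and
at least `0` for `g = 0`. -/
theorem nonneg_of_mem_massGaps_zero (K : Hypergroup H) {f : C_c(H, ℝ)}
    (hp : K.PositivityOfTranslations f) {r : ℝ} (hr : r ∈ K.massGaps f 0) : 0 ≤ r := by
  obtain ⟨μ, ν, _, _, _, _, h, rfl⟩ := hr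
  refine sub_nonneg.2 (ENNReal.toReal_mono (measure_ne_top μ _) (hp ν μ fun x => ?_))
  simpa using h x

theorem smul_mem_massGaps (K : Hypergroup H) {f g : C_c(H, ℝ)} {r c : ℝ} (hc : 0 ≤ c)
    (hr : r ∈ K.massGaps f g) : c * r ∈ K.massGaps f (c • g) := by
  obtain ⟨μ, ν, _, _, _, _, h, rfl⟩ := hr
  lift c to NNReal using hc
  refine ⟨c • μ, c • ν, inferInstance, inferInstance, inferInstance, inferInstance,
    fun x => ?_, ?_⟩
  · rw [convFun_smul, convFun_smul]
    change c * g x + _ ≤ _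
    rw [← mul_add]
    exact mul_le_mul_of_nonneg_left (h x) c.2
  · rw [measureReal_nnreal_smul_apply, measureReal_nnreal_smul_apply, mul_sub]

theorem add_mem_massGaps [T2Space H] (K : Hypergroup H) {f g h : C_c(H, ℝ)} {r s : ℝ}
    (hr : r ∈ K.massGaps f g) (hs : s ∈ K.massGaps f h) : r + s ∈ K.massGaps f (g + h) := by
  obtain ⟨μ, ν, _, _, _, _, hg, rfl⟩ := hr
  obtain ⟨μ', ν', _, _, _, _, hh, rfl⟩ := hs
  refine ⟨μ + μ', ν + ν', inferInstance, inferInstance, inferInstance, inferInstance,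
    fun x => ?_, ?_⟩
  · rw [convFun_add, convFun_add, CompactlySupportedContinuousMap.add_apply]
    linarith [hg x, hh x]
  · rw [measureReal_add_apply, measureReal_add_apply]; ring

theorem le_smul_of_forall_one_le {X : Type*} [TopologicalSpace X] {g h : C_c(X, ℝ)} {L : Set X}
    (h0 : 0 ≤ h) (h1 : ∀ x ∈ L, 1 ≤ h x) (hg : ∀ x, g x ≠ 0 → x ∈ L) {M : ℝ} (hM0 : 0 ≤ M)
    (hM : ∀ x, |g x| ≤ M) : g ≤ M • h := by
  intro x
  change g x ≤ M * h x
  by_cases hx : g x = 0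
  · rw [hx]; exact mul_nonneg hM0 (h0 x)
  · calc g x ≤ M * 1 := by rw [mul_one]; exact (le_abs_self _).trans (hM x)
      _ ≤ M * h x := mul_le_mul_of_nonneg_left (h1 x (hg x hx)) hM0

/-! ### Left translation on compactly supported functions -/

variable [T2Space H] [LocallyCompactSpace H]

/-- `δ_a ∗ g` is supported in `A ∗ B` for `a ∈ A` and `g` supported in `B`. -/
theorem mem_setConv_of_integral_ne_zero (K : Hypergroup H) {A B : Set H} {g : H → ℝ}
    (hg : ∀ t, g t ≠ 0 → t ∈ B) {a x : H} (ha : a ∈ A)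
    (h : ∫ t, g t ∂(K.conv (K.inv a) x : Measure H) ≠ 0) : x ∈ K.setConv A B := by
  obtain ⟨t, ht, hne⟩ := exists_mem_support_of_integral_ne_zero h
  have := K.mem_support_inv_conv ht
  rw [K.inv_inv] at this
  exact K.mem_setConv.2 ⟨a, ha, t, hg t hne, this⟩

/-- The left translate `δ_y ∗ g` of a compactly supported continuous function. -/
noncomputable def trans (K : Hypergroup H) (y : H) : C_c(H, ℝ) →ₗ[ℝ] C_c(H, ℝ) where
  toFun g := ⟨⟨fun x => ∫ t, g t ∂(K.conv (K.inv y) x : Measure H),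
    (K.continuous_integral_inv_conv g).comp (Continuous.prodMk_right y)⟩,
    HasCompactSupport.intro (K.isCompact_setConv isCompact_singleton g.hasCompactSupport)
      fun x hx => by
        by_contra hne
        exact hx (K.mem_setConv_of_integral_ne_zero (A := {y})
          (fun t ht => subset_tsupport g ht) rfl hne)⟩
  map_add' g h := by
    ext x
    exact integral_add (K.integrable_conv g _ _) (K.integrable_conv h _ _)
  map_smul' c g := by
    ext x
    exact integral_const_mul c _

theorem trans_apply (K : Hypergroup H) (y : H) (g : C_c(H, ℝ)) (x : H) :
    K.trans y g x = ∫ t, g t ∂(K.conv (K.inv y) x : Measure H) := rfl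

theorem convFun_dirac_eq_trans (K : Hypergroup H) (y : H) (g : C_c(H, ℝ)) :
    K.convFun (Measure.dirac y) g = K.trans y g := by
  ext x
  rw [convFun_dirac, trans_apply]

theorem trans_nonneg (K : Hypergroup H) (y : H) {g : C_c(H, ℝ)} (hg : 0 ≤ g) : 0 ≤ K.trans y g :=
  fun _ => integral_nonneg hg

theorem trans_mono (K : Hypergroup H) (y : H) {g h : C_c(H, ℝ)} (hg : g ≤ h) :
    K.trans y g ≤ K.trans y h := fun _ =>
  integral_mono (K.integrable_conv g _ _) (K.integrable_conv h _ _) hg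

theorem trans_e (K : Hypergroup H) (g : C_c(H, ℝ)) : K.trans K.e g = g := by
  ext x
  rw [trans_apply, K.inv_e, K.e_conv, integral_dirac]

/-- `δ_a ∗ (δ_y ∗ g) = (δ_a ∗ δ_y) ∗ g`. -/
theorem trans_trans (K : Hypergroup H) (a y : H) (g : C_c(H, ℝ)) (x : H) :
    K.trans a (K.trans y g) x = K.convFun (K.conv a y : Measure H) g x := by
  have h := K.conv_assoc_real (K.inv y) (K.inv a) x (ofCc g)
  simp only [ofCc_apply] at h
  simp only [trans_apply, convFun]
  rw [← h, K.integral_conv_eq_inv a y (F := fun t => ∫ s, g s ∂(K.conv t x : Measure H))]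
  exact (K.continuous_integral_conv (ofCc g)).comp (Continuous.prodMk_left x)

/-- Left translation is continuous in the uniform norm, with locally common compact support. -/
theorem exists_trans_near (K : Hypergroup H) (g : C_c(H, ℝ)) (y : H) : ∃ L : Set H, IsCompact L ∧
    ∀ ε > 0, ∀ᶠ z in 𝓝 y, ∀ x, |(K.trans z g - K.trans y g) x| ≤ ε ∧
      ((K.trans z g - K.trans y g) x ≠ 0 → x ∈ L) := by
  obtain ⟨A, hA, hAy⟩ := exists_compact_mem_nhds y
  have hL := K.isCompact_setConv hA g.hasCompactSupport
  refine ⟨_, hL, fun ε hε => ?_⟩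
  have hsupp : ∀ z ∈ A, ∀ x, K.trans z g x ≠ 0 → x ∈ K.setConv A (tsupport g) := fun z hz x hx =>
    K.mem_setConv_of_integral_ne_zero (fun t ht => subset_tsupport g ht) hz hx
  have hunif : ∀ᶠ z in 𝓝 y, ∀ x ∈ K.setConv A (tsupport g),
      |(K.trans z g - K.trans y g) x| < ε := by
    refine hL.eventually_forall_of_forall_eventually fun x _ => ?_
    have hc : Continuous fun p : H × H => |(K.trans p.1 g - K.trans y g) p.2| := by
      simp only [CompactlySupportedContinuousMap.sub_apply]
      exact ((K.continuous_integral_inv_conv g).sub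
        ((K.trans y g).continuous.comp continuous_snd)).abs
    exact hc.continuousAt.eventually_lt continuousAt_const (by simpa using hε)
  filter_upwards [hunif, hAy] with z hz hzA x
  have hx : (K.trans z g - K.trans y g) x ≠ 0 → x ∈ K.setConv A (tsupport g) := by
    intro hne
    by_contra hx
    have h1 := not_imp_comm.1 (hsupp z hzA x) hx
    have h2 := not_imp_comm.1 (hsupp y (mem_of_mem_nhds hAy) x) hx
    simp [h1, h2] at hne
  refine ⟨?_, hx⟩
  by_cases h : (K.trans z g - K.trans y g) x = 0
  · rw [h]; simpa using hε.le
  · exact (hz x (hx h)).le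

/-- Finitely many translates of `f` dominate the indicator function of a compact set `L`; they add
up to a function `h` all of whose translates lie below some `ν ∗ f` with `‖ν‖` bounded. -/
theorem exists_dominating (K : Hypergroup H) {f : C_c(H, ℝ)} (h0 : 0 ≤ f) (hf : f ≠ 0) {L : Set H}
    (hL : IsCompact L) : ∃ (C : ℝ) (h : C_c(H, ℝ)), 0 ≤ h ∧ (∀ x ∈ L, 1 ≤ h x) ∧
      ∀ a, ∃ ν : Measure H, IsFiniteMeasure ν ∧ ν.Regular ∧ ν.real Set.univ ≤ C ∧
        ∀ t, K.trans a h t ≤ K.convFun ν f t := by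
  refine hL.induction_on (p := fun L => ∃ (C : ℝ) (h : C_c(H, ℝ)), 0 ≤ h ∧ (∀ x ∈ L, 1 ≤ h x) ∧
      ∀ a, ∃ ν : Measure H, IsFiniteMeasure ν ∧ ν.Regular ∧ ν.real Set.univ ≤ C ∧
        ∀ t, K.trans a h t ≤ K.convFun ν f t) ?_ ?_ ?_ ?_
  · refine ⟨0, 0, le_rfl, by simp, fun a => ⟨0, inferInstance, inferInstance, by simp, fun t => ?_⟩⟩
    simp [convFun]
  · rintro S T hST ⟨C, h, h1, h2, h3⟩
    exact ⟨C, h, h1, fun x hx => h2 x (hST hx), h3⟩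
  · rintro S T ⟨C, h, h1, h2, h3⟩ ⟨C', h', h1', h2', h3'⟩
    refine ⟨C + C', h + h', add_nonneg h1 h1', ?_, fun a => ?_⟩
    · rintro x (hx | hx)
      · have := h2 x hx; have := h1' x
        simp only [CompactlySupportedContinuousMap.coe_zero, Pi.zero_apply] at this
        simp only [CompactlySupportedContinuousMap.add_apply]; linarith
      · have := h2' x hx; have := h1 x
        simp only [CompactlySupportedContinuousMap.coe_zero, Pi.zero_apply] at this
        simp only [CompactlySupportedContinuousMap.add_apply]; linarith
    · obtain ⟨ν, _, _, hC, hν⟩ := h3 a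
      obtain ⟨ν', _, _, hC', hν'⟩ := h3' a
      refine ⟨ν + ν', inferInstance, inferInstance, ?_, fun t => ?_⟩
      · rw [measureReal_add_apply]; exact add_le_add hC hC'
      · rw [map_add, convFun_add]; exact add_le_add (hν t) (hν' t)
  · intro x hx
    obtain ⟨u, hu⟩ : ∃ u, f u ≠ 0 := by
      by_contra! hc
      exact hf (by ext x; simpa using hc x)
    -- A point `w` of `u ∗ x̌` has `u ∈ w ∗ x`, so that `δ_w̌ ∗ f` is positive at `x`.
    obtain ⟨w, hw⟩ := K.support_conv_nonempty u (K.inv x)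
    have hpos : 0 < K.trans (K.inv w) f x := by
      rw [trans_apply, K.inv_inv]
      refine integral_pos_of_mem_support f.continuous (K.integrable_conv f _ _) h0 (x := u) ?_
        (lt_of_le_of_ne (h0 u) hu.symm)
      have h1 := K.inv_mem_support_of_mem (K.mem_support_inv_conv hw)
      simp only [K.inv_inv] at h1
      simpa only [K.inv_inv] using K.mem_support_inv_conv h1
    set y := K.inv w
    -- The factor makes the translate equal to `2` at `x`, hence at least `1` near `x`.
    let c : NNReal := ⟨2 / K.trans y f x, by positivity⟩
    refine ⟨{z | 1 ≤ (c • K.trans y f) z}, mem_nhdsWithin_of_mem_nhds ?_, c, c • K.trans y f, ?_,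
      fun z hz => hz, fun a => ⟨c • (K.conv a y : Measure H), inferInstance,
        inferInstance, ?_, fun t => ?_⟩⟩
    · refine ((c • K.trans y f).continuous.continuousAt).eventually_const_le ?_
      change 1 < (2 / K.trans y f x) * K.trans y f x
      rw [div_mul_cancel₀ _ hpos.ne']; norm_num
    · exact fun z => mul_nonneg c.2 (K.trans_nonneg y h0 z)
    · simp [measureReal_def]
    · rw [convFun_smul, ← trans_trans]
      change K.trans a ((c : ℝ) • K.trans y f) t ≤ _
      rw [map_smul]; rfl

/-! ### A positive functional constant on the translates of `f` -/

/-- Some `ν ∗ f` dominates `g`. -/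
theorem massGaps_nonempty (K : Hypergroup H) {f : C_c(H, ℝ)} (h0 : 0 ≤ f) (hf : f ≠ 0)
    (g : C_c(H, ℝ)) : (K.massGaps f g).Nonempty := by
  obtain ⟨C, h, hh0, hh1, hν⟩ := K.exists_dominating h0 hf g.hasCompactSupport
  obtain ⟨ν, _, _, -, hν⟩ := hν K.e
  have hle : g ≤ ‖ofCc g‖ • h := le_smul_of_forall_one_le hh0 hh1
    (fun x hx => subset_tsupport g hx) (norm_nonneg _) fun x => (ofCc g).norm_coe_le_norm x
  refine ⟨_, ‖ofCc g‖₊ • ν, 0, inferInstance, inferInstance, inferInstance, inferInstance,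
    fun x => ?_, rfl⟩
  have h2 := hν x
  rw [trans_e] at h2
  rw [convFun_smul, convFun, integral_zero_measure, add_zero]
  exact (hle x).trans (mul_le_mul_of_nonneg_left h2 (norm_nonneg _))

theorem bddBelow_massGaps (K : Hypergroup H) {f : C_c(H, ℝ)} (h0 : 0 ≤ f) (hf : f ≠ 0)
    (hp : K.PositivityOfTranslations f) (g : C_c(H, ℝ)) : BddBelow (K.massGaps f g) := by
  obtain ⟨s, hs⟩ := K.massGaps_nonempty h0 hf (-g)
  refine ⟨-s, fun r hr => ?_⟩
  have h := K.add_mem_massGaps hr hs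
  rw [add_neg_cancel] at h
  linarith [K.nonneg_of_mem_massGaps_zero hp h]

/-- Hahn–Banach, applied to the sublinear functional `g ↦ inf (massGaps f g)`. -/
theorem exists_linear_le_massGaps (K : Hypergroup H) {f : C_c(H, ℝ)} (h0 : 0 ≤ f) (hf : f ≠ 0)
    (hp : K.PositivityOfTranslations f) :
    ∃ Λ : C_c(H, ℝ) →ₗ[ℝ] ℝ, ∀ g, ∀ r ∈ K.massGaps f g, Λ g ≤ r := by
  have hb := K.bddBelow_massGaps h0 hf hp
  have hn := K.massGaps_nonempty h0 hf
  have hle : ∀ c : ℝ, 0 < c → ∀ g, sInf (K.massGaps f (c • g)) ≤ c * sInf (K.massGaps f g) := by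
    intro c hc g
    rw [← div_le_iff₀' hc]
    refine le_csInf (hn g) fun r hr => ?_
    rw [div_le_iff₀' hc]
    exact csInf_le (hb _) (K.smul_mem_massGaps hc.le hr)
  have hhom : ∀ c : ℝ, 0 < c → ∀ g, sInf (K.massGaps f (c • g)) = c * sInf (K.massGaps f g) := by
    intro c hc g
    refine (hle c hc g).antisymm ?_
    have := hle c⁻¹ (inv_pos.2 hc) (c • g)
    rwa [inv_smul_smul₀ hc.ne', ← div_eq_inv_mul, le_div_iff₀' hc] at this
  have hadd : ∀ g h, sInf (K.massGaps f (g + h)) ≤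
      sInf (K.massGaps f g) + sInf (K.massGaps f h) := by
    intro g h
    rw [← sub_le_iff_le_add]
    refine le_csInf (hn g) fun r hr => ?_
    rw [sub_le_comm]
    refine le_csInf (hn h) fun s hs => ?_
    rw [sub_le_iff_le_add']
    exact csInf_le (hb _) (K.add_mem_massGaps hr hs)
  obtain ⟨Λ, -, hΛ⟩ := exists_extension_of_le_sublinear (⊥ : C_c(H, ℝ) →ₗ.[ℝ] ℝ)
    (fun g => sInf (K.massGaps f g)) hhom hadd fun x => by
      obtain ⟨x, hx⟩ := x
      obtain rfl : x = 0 := (Submodule.mem_bot ℝ).1 hx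
      have h0 : (⊥ : C_c(H, ℝ) →ₗ.[ℝ] ℝ) ⟨0, hx⟩ = 0 := LinearPMap.map_zero _
      rw [h0]
      exact le_csInf (hn _) fun r hr => K.nonneg_of_mem_massGaps_zero hp hr
  exact ⟨Λ, fun g r hr => (hΛ g).trans (csInf_le (hb g) hr)⟩

/-- `Λ` is bounded along left translates: `|Λ (δ_a ∗ g)| ≤ C ‖g‖` for all `a`, with a constant `C`
that depends only on a compact set in which `g` is supported. -/
def TranslationBounded (K : Hypergroup H) (Λ : C_c(H, ℝ) →ₗ[ℝ] ℝ) : Prop :=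
  ∀ L : Set H, IsCompact L → ∃ C : ℝ, 0 ≤ C ∧ ∀ (g : C_c(H, ℝ)) (M : ℝ),
    (∀ x, |g x| ≤ M ∧ (g x ≠ 0 → x ∈ L)) → ∀ a, |Λ (K.trans a g)| ≤ C * M

/-- A linear functional below the mass gaps lies between the masses of the measures with
`μ ∗ f ≤ g ≤ ν ∗ f`. So it is positive and has the value `1` on the translates of `f`, and it is
bounded along translates because `exists_dominating` bounds the masses uniformly. -/
theorem exists_normalized_functional (K : Hypergroup H) {f : C_c(H, ℝ)} (h0 : 0 ≤ f) (hf : f ≠ 0)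
    (hp : K.PositivityOfTranslations f) :
    ∃ Λ : C_c(H, ℝ) →ₗ[ℝ] ℝ, (∀ g, 0 ≤ g → 0 ≤ Λ g) ∧ (∀ y, Λ (K.trans y f) = 1) ∧
      K.TranslationBounded Λ := by
  obtain ⟨Λ, hΛ⟩ := K.exists_linear_le_massGaps h0 hf hp
  have hupper : ∀ (g : C_c(H, ℝ)) (μ : Measure H) [IsFiniteMeasure μ] [μ.Regular],
      (∀ x, g x ≤ K.convFun μ f x) → Λ g ≤ μ.real Set.univ := by
    intro g μ _ _ h
    refine hΛ g _ ⟨μ, 0, inferInstance, inferInstance, inferInstance, inferInstance,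
      fun x => ?_, by simp⟩
    simpa [convFun] using h x
  have hlower : ∀ (g : C_c(H, ℝ)) (μ : Measure H) [IsFiniteMeasure μ] [μ.Regular],
      (∀ x, K.convFun μ f x ≤ g x) → μ.real Set.univ ≤ Λ g := by
    intro g μ _ _ h
    have := hΛ (-g) (-μ.real Set.univ) ⟨0, μ, inferInstance, inferInstance, inferInstance,
      inferInstance, fun x => ?_, by simp⟩
    · rw [map_neg] at this; linarith
    · have := h x
      simp only [convFun, integral_zero_measure, CompactlySupportedContinuousMap.neg_apply] at this ⊢
      linarith
  have hnn : ∀ g, 0 ≤ g → 0 ≤ Λ g := fun g hg => by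
    simpa using hlower g 0 (fun x => by simpa [convFun] using hg x)
  have hmono : ∀ g h, g ≤ h → Λ g ≤ Λ h := fun g h hgh => by
    have := hnn (h - g) (fun x => by simpa using hgh x)
    rw [map_sub] at this; linarith
  refine ⟨Λ, hnn, fun y => ?_, fun L hL => ?_⟩
  · have hreg : (Measure.dirac y : Measure H).Regular := by
      rw [← K.conv_e y]; infer_instance
    have he : ∀ x, K.trans y f x = K.convFun (Measure.dirac y) f x := fun x => by
      rw [convFun_dirac_eq_trans]
    have h1 := hupper (K.trans y f) (Measure.dirac y) fun x => (he x).le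
    have h2 := hlower (K.trans y f) (Measure.dirac y) fun x => (he x).ge
    rw [probReal_univ] at h1 h2
    exact le_antisymm h1 h2
  · obtain ⟨C, h, hh0, hh1, hν⟩ := K.exists_dominating h0 hf hL
    have hC : ∀ a, Λ (K.trans a h) ≤ C := fun a => by
      obtain ⟨ν, _, _, hνC, hν⟩ := hν a
      exact (hupper _ ν hν).trans hνC
    refine ⟨C, (hnn _ (K.trans_nonneg K.e hh0)).trans (hC _), fun g M hg a => ?_⟩
    have hM0 : 0 ≤ M := (abs_nonneg _).trans (hg K.e).1
    have key : ∀ g : C_c(H, ℝ), (∀ x, |g x| ≤ M ∧ (g x ≠ 0 → x ∈ L)) →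
        Λ (K.trans a g) ≤ C * M := fun g hg => by
      have := hmono _ _ (K.trans_mono a
        (le_smul_of_forall_one_le hh0 hh1 (fun x => (hg x).2) hM0 fun x => (hg x).1))
      rw [map_smul, map_smul, smul_eq_mul] at this
      exact this.trans ((mul_le_mul_of_nonneg_left (hC a) hM0).trans_eq (mul_comm _ _))
    refine abs_le'.2 ⟨key g hg, ?_⟩
    have := key (-g) fun x => by simpa using hg x
    rwa [map_neg, map_neg] at this

/-! ### Averaging over the translates -/

/-- A function that is bounded in terms of the uniform norm, on functions supported in a fixed
compact set, is small on `δ_z ∗ g - δ_y ∗ g` for `z` near `y`. -/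
theorem eventually_trans_sub_lt (K : Hypergroup H) {P : C_c(H, ℝ) → ℝ}
    (hP : ∀ L : Set H, IsCompact L → ∃ C : ℝ, 0 ≤ C ∧ ∀ (g : C_c(H, ℝ)) (M : ℝ),
      (∀ x, |g x| ≤ M ∧ (g x ≠ 0 → x ∈ L)) → P g ≤ C * M)
    (g : C_c(H, ℝ)) (y : H) {ε : ℝ} (hε : 0 < ε) :
    ∀ᶠ z in 𝓝 y, P (K.trans z g - K.trans y g) < ε := by
  obtain ⟨L, hL, hnear⟩ := K.exists_trans_near g y
  obtain ⟨C, hC, hb⟩ := hP L hL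
  filter_upwards [hnear (ε / (C + 1)) (by positivity)] with z hz
  refine (hb _ _ hz).trans_lt ?_
  rw [mul_div_assoc', div_lt_iff₀ (by positivity)]
  nlinarith

theorem TranslationBounded.continuous_trans {K : Hypergroup H} {Λ : C_c(H, ℝ) →ₗ[ℝ] ℝ}
    (hΛ : K.TranslationBounded Λ) (g : C_c(H, ℝ)) : Continuous fun x => Λ (K.trans x g) := by
  rw [continuous_iff_continuousAt]
  intro y
  rw [ContinuousAt, Metric.tendsto_nhds]
  intro ε hε
  have := K.eventually_trans_sub_lt (P := fun g => |Λ g|) (fun L hL => by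
    obtain ⟨C, hC, hb⟩ := hΛ L hL
    exact ⟨C, hC, fun g M hg => by simpa only [trans_e] using hb g M hg K.e⟩) g y hε
  filter_upwards [this] with z hz
  rwa [map_sub] at hz

theorem TranslationBounded.exists_bound {K : Hypergroup H} {Λ : C_c(H, ℝ) →ₗ[ℝ] ℝ}
    (hΛ : K.TranslationBounded Λ) (g : C_c(H, ℝ)) : ∃ C, ∀ x, |Λ (K.trans x g)| ≤ C := by
  obtain ⟨C, -, hb⟩ := hΛ _ g.hasCompactSupport
  exact ⟨C * ‖ofCc g‖, hb g ‖ofCc g‖ fun x =>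
    ⟨(ofCc g).norm_coe_le_norm x, fun hx => subset_tsupport g hx⟩⟩

/-- The bounded continuous function `x ↦ Λ (δ_x̌ ∗ g)`, to which an invariant mean will be
applied. With the involution, translation of `g` becomes translation of this function. -/
noncomputable def orbitFun (K : Hypergroup H) (Λ : C_c(H, ℝ) →ₗ[ℝ] ℝ)
    (hΛ : K.TranslationBounded Λ) : C_c(H, ℝ) →ₗ[ℝ] (H →ᵇ ℂ) where
  toFun g := BoundedContinuousFunction.ofNormedAddCommGroup
    (fun x => (Λ (K.trans (K.inv x) g) : ℂ))
    (Complex.continuous_ofReal.comp ((hΛ.continuous_trans g).comp K.inv.continuous))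
    (hΛ.exists_bound g).choose
    (fun x => by simpa using (hΛ.exists_bound g).choose_spec (K.inv x))
  map_add' g h := by ext x; simp
  map_smul' c g := by ext x; simp

theorem orbitFun_apply (K : Hypergroup H) (Λ : C_c(H, ℝ) →ₗ[ℝ] ℝ) (hΛ : K.TranslationBounded Λ)
    (g : C_c(H, ℝ)) (x : H) : K.orbitFun Λ hΛ g x = (Λ (K.trans (K.inv x) g) : ℂ) := rfl

/-- A positive functional commutes with the integral of translates against `δ_a ∗ δ_y`; its
representing measure need not be σ-finite, so Fubini is applied to a compactly supported
function. -/
theorem integral_functional_trans (K : Hypergroup H) (Λ : C_c(H, ℝ) →ₗ[ℝ] ℝ)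
    (hpos : ∀ g, 0 ≤ g → 0 ≤ Λ g) (a y : H) (g : C_c(H, ℝ)) :
    ∫ t, Λ (K.trans t g) ∂(K.conv a y : Measure H) = Λ (K.trans a (K.trans y g)) := by
  set ρ := RealRMK.rieszMeasure (PositiveLinearMap.mk₀ Λ hpos) with hρ
  have hrep : ∀ h, Λ h = ∫ x, h x ∂ρ := fun h =>
    (RealRMK.integral_rieszMeasure (PositiveLinearMap.mk₀ Λ hpos) h).symm
  obtain ⟨χ, h1, -, hχ, -⟩ := exists_continuous_one_zero_of_isCompact
    (K.isCompact_support a y) isClosed_empty (Set.disjoint_empty _)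
  have hae : ∀ᵐ t ∂(K.conv a y : Measure H), χ t = 1 := by
    filter_upwards [K.ae_mem_support_conv a y] with t ht using h1 ht
  have hcomp : HasCompactSupport (Function.uncurry fun t x => χ t * K.trans t g x) := by
    refine HasCompactSupport.intro (hχ.isCompact.prod
      (K.isCompact_setConv hχ.isCompact g.hasCompactSupport)) ?_
    rintro ⟨t, x⟩ hp
    by_contra hne
    have ht : t ∈ tsupport χ := subset_tsupport χ (left_ne_zero_of_mul hne)
    exact hp ⟨ht, K.mem_setConv_of_integral_ne_zero (fun s hs => subset_tsupport g hs) ht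
      (right_ne_zero_of_mul hne)⟩
  have hswap := integral_integral_swap_of_hasCompactSupport
    (((χ.continuous.comp continuous_fst).mul (K.continuous_integral_inv_conv g)) :
      Continuous (Function.uncurry fun t x => χ t * K.trans t g x)) hcomp
    (μ := (K.conv a y : Measure H)) (ν := ρ)
  calc ∫ t, Λ (K.trans t g) ∂(K.conv a y : Measure H)
      = ∫ t, ∫ x, χ t * K.trans t g x ∂ρ ∂(K.conv a y : Measure H) := by
        refine integral_congr_ae ?_
        filter_upwards [hae] with t ht
        simp only [ht, one_mul, hrep]
    _ = ∫ x, ∫ t, χ t * K.trans t g x ∂(K.conv a y : Measure H) ∂ρ := hswap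
    _ = ∫ x, K.trans a (K.trans y g) x ∂ρ := by
        refine integral_congr_ae (Eventually.of_forall fun x => ?_)
        simp only [trans_trans, convFun]
        refine integral_congr_ae ?_
        filter_upwards [hae] with t ht
        rw [ht, one_mul, trans_apply]
    _ = Λ (K.trans a (K.trans y g)) := (hrep _).symm

theorem leftTranslate_orbitFun (K : Hypergroup H) (Λ : C_c(H, ℝ) →ₗ[ℝ] ℝ)
    (hΛ : K.TranslationBounded Λ) (hpos : ∀ g, 0 ≤ g → 0 ≤ Λ g) (y : H) (g : C_c(H, ℝ)) :
    K.leftTranslate y (K.orbitFun Λ hΛ g) = K.orbitFun Λ hΛ (K.trans y g) := by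
  ext x
  rw [leftTranslate_apply]
  simp only [orbitFun_apply]
  rw [integral_complex_ofReal, ← K.integral_functional_trans Λ hpos]
  congr 1
  have h := K.integral_conv_eq_inv (K.inv x) y (F := fun t => Λ (K.trans (K.inv t) g))
    ((hΛ.continuous_trans g).comp K.inv.continuous)
  simpa only [K.inv_inv] using h

/-- The functions `x ↦ Λ (δ_x̌ ∗ g)` are even norm continuous under left translation. -/
theorem orbitFun_mem_WUCB (K : Hypergroup H) (Λ : C_c(H, ℝ) →ₗ[ℝ] ℝ)
    (hΛ : K.TranslationBounded Λ) (hpos : ∀ g, 0 ≤ g → 0 ≤ Λ g) (g : C_c(H, ℝ)) :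
    K.orbitFun Λ hΛ g ∈ K.WUCB := by
  intro F
  refine F.continuous.comp ?_
  simp only [K.leftTranslate_orbitFun Λ hΛ hpos]
  rw [continuous_iff_continuousAt]
  intro y
  rw [ContinuousAt, Metric.tendsto_nhds]
  intro ε hε
  have := K.eventually_trans_sub_lt (P := fun g => ‖K.orbitFun Λ hΛ g‖) (fun L hL => by
    obtain ⟨C, hC, hb⟩ := hΛ L hL
    refine ⟨C, hC, fun g M hg => ?_⟩
    have hM : 0 ≤ M := (abs_nonneg _).trans (hg K.e).1
    refine (BoundedContinuousFunction.norm_le (mul_nonneg hC hM)).2 fun x => ?_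
    rw [orbitFun_apply, Complex.norm_real]
    exact hb g M hg _) g y hε
  filter_upwards [this] with z hz
  rwa [dist_eq_norm, ← map_sub]

/-- The averaged functional is left invariant, since translation of `g` amounts to translation of
`x ↦ Λ (δ_x̌ ∗ g)`. -/
theorem exists_invariant_functional (K : Hypergroup H) {f : C_c(H, ℝ)} (h0 : 0 ≤ f) (hf : f ≠ 0)
    (hp : K.PositivityOfTranslations f) {m : K.WUCB →L[ℂ] ℂ} (hm : K.IsLeftInvariantMean m) :
    ∃ I : C_c(H, ℝ) →ₗ[ℝ] ℝ, (∀ g, 0 ≤ g → 0 ≤ I g) ∧ I f = 1 ∧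
      ∀ y g, I (K.trans y g) = I g := by
  obtain ⟨Λ, hpos, hone, hΛ⟩ := K.exists_normalized_functional h0 hf hp
  have hmem := K.orbitFun_mem_WUCB Λ hΛ hpos
  refine ⟨{ toFun := fun g => (m ⟨K.orbitFun Λ hΛ g, hmem g⟩).re
            map_add' := fun g h => ?_
            map_smul' := fun c g => ?_ }, fun g hg => ?_, ?_, fun y g => ?_⟩
  · rw [← Complex.add_re, ← map_add]
    congr 2
    exact Subtype.ext (map_add _ g h)
  · have : (⟨K.orbitFun Λ hΛ (c • g), hmem _⟩ : K.WUCB) =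
        (c : ℂ) • ⟨K.orbitFun Λ hΛ g, hmem g⟩ := by
      refine Subtype.ext ?_
      ext x
      simp [orbitFun_apply]
    rw [this, map_smul, smul_eq_mul, Complex.re_ofReal_mul]; rfl
  · exact hm.re_nonneg (hmem g) (r := fun x => Λ (K.trans (K.inv x) g))
      (fun x => hpos _ (K.trans_nonneg _ hg)) fun x => rfl
  · change (m ⟨K.orbitFun Λ hΛ f, hmem f⟩).re = 1
    have : (⟨K.orbitFun Λ hΛ f, hmem f⟩ : K.WUCB) = ⟨1, K.one_mem_WUCB⟩ := by
      refine Subtype.ext ?_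
      ext x
      simp [orbitFun_apply, hone]
    rw [this, hm.2.1, Complex.one_re]
  · change (m ⟨K.orbitFun Λ hΛ (K.trans y g), hmem _⟩).re = (m ⟨K.orbitFun Λ hΛ g, hmem g⟩).re
    have h := hm.2.2 y (K.orbitFun Λ hΛ g) (hmem g)
      (by rw [K.leftTranslate_orbitFun Λ hΛ hpos]; exact hmem _)
    simp only [K.leftTranslate_orbitFun Λ hΛ hpos] at h
    rw [h]

theorem integral_add_mul_I {X : Type*} [TopologicalSpace X] [MeasurableSpace X]
    [OpensMeasurableSpace X] (μ : Measure X) [IsFiniteMeasureOnCompacts μ] (u v : C_c(X, ℝ)) :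
    ∫ x, ((u x : ℂ) + v x * Complex.I) ∂μ = (∫ x, u x ∂μ : ℝ) + (∫ x, v x ∂μ : ℝ) * Complex.I := by
  rw [integral_add, integral_mul_const, integral_complex_ofReal, integral_complex_ofReal]
  · exact (u.continuous.integrable_of_hasCompactSupport u.hasCompactSupport).ofReal
  · exact (v.continuous.integrable_of_hasCompactSupport v.hasCompactSupport).ofReal.mul_const _

end Hypergroup

theorem theorem4p4 {H : Type*} [TopologicalSpace H] [T2Space H] [LocallyCompactSpace H]
    [MeasurableSpace H] [BorelSpace H] (K : Hypergroup H)
    (hpos : ∃ f : H → ℝ, Continuous f ∧ HasCompactSupport f ∧ (∀ x, 0 ≤ f x) ∧ f ≠ 0 ∧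
      K.PositivityOfTranslations f)
    (hmean : ∃ m : K.WUCB →L[ℂ] ℂ, K.IsLeftInvariantMean m) :
    ∃ ℓ : Measure H, K.IsLeftHaar ℓ := by
  obtain ⟨f, hfc, hfs, hf0, hfne, hp⟩ := hpos
  obtain ⟨m, hm⟩ := hmean
  obtain ⟨I, hI, hI1, hinv⟩ := K.exists_invariant_functional (f := ⟨⟨f, hfc⟩, hfs⟩) hf0
    (fun h => hfne (congrArg (fun g : C_c(H, ℝ) => (g : H → ℝ)) h)) hp hm
  set ℓ := RealRMK.rieszMeasure (PositiveLinearMap.mk₀ I hI)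
  have hrep : ∀ h : C_c(H, ℝ), ∫ x, h x ∂ℓ = I h := fun h =>
    RealRMK.integral_rieszMeasure (PositiveLinearMap.mk₀ I hI) h
  -- A complex `g` is `u + i v` with real `u`, `v`, and its translate is `δ_x ∗ u + i (δ_x ∗ v)`.
  have hsplit : ∀ g : H → ℂ, Continuous g → HasCompactSupport g → ∃ u v : C_c(H, ℝ),
      g = (fun t => (u t : ℂ) + v t * Complex.I) ∧ ∀ x, K.convFun (Measure.dirac x) g =
        fun y => (K.trans x u y : ℂ) + K.trans x v y * Complex.I := by
    intro g hg hgs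
    let u : C_c(H, ℝ) := ⟨⟨fun t => (g t).re, by fun_prop⟩, hgs.comp_left Complex.zero_re⟩
    let v : C_c(H, ℝ) := ⟨⟨fun t => (g t).im, by fun_prop⟩, hgs.comp_left Complex.zero_im⟩
    have huv : g = fun t => (u t : ℂ) + v t * Complex.I :=
      funext fun t => (Complex.re_add_im (g t)).symm
    refine ⟨u, v, huv, fun x => funext fun y => ?_⟩
    rw [K.convFun_dirac]
    conv_lhs => rw [huv]
    exact Hypergroup.integral_add_mul_I _ u v
  refine ⟨ℓ, ⟨inferInstance, ?_, fun x g hg hgs => ?_, fun x g hg hgs => ?_⟩⟩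
  · intro h
    have := hrep ⟨⟨f, hfc⟩, hfs⟩
    rw [hI1, h, integral_zero_measure] at this
    exact zero_ne_one this
  · obtain ⟨u, v, -, h⟩ := hsplit g hg hgs
    rw [h]
    have hi : ∀ w : C_c(H, ℝ), Integrable (fun y => (w y : ℂ)) ℓ := fun w =>
      (w.continuous.integrable_of_hasCompactSupport w.hasCompactSupport).ofReal
    exact (hi _).add ((hi _).mul_const _)
  · obtain ⟨u, v, hg', h⟩ := hsplit g hg hgs
    rw [h, hg', Hypergroup.integral_add_mul_I, Hypergroup.integral_add_mul_I]
    simp only [hrep, hinv]
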